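/- Let $(X,\Sigma,\mu)$ be a finite measure space and $H=L^2(X)$ (complex-valued functions), with scalar product $(\cdot|\cdot)_H$ linear in the first argument. Let $(a,j)$ be a sectorial form in $H$: $D(a)$ is a complex vector space, $a\colon D(a)\times D(a)\to\mathbb{C}$ is sesquilinear, $j\colon D(a)\to H$ is linear with dense image, and there are $\omega\in\mathbb{R}$ and $\theta\in[0,\frac{\pi}{2})$ such that $a(u,u)+\omega\|j(u)\|_H^2\in\{re^{i\alpha}: r\ge 0,\ |\alpha|\le\theta\}$ for all $u\in D(a)$. Let $A$ be the operator in $H$ associated with $(a,j)$: for $x,y\in H$ one has $x\in D(A)$ and $Ax=y$ if and only if there is a sequence $(u_n)$ in $D(a)$ such that $j(u_n)\to x$ in $H$, $a(u_n-u_m,u_n-u_m)\to 0$ as $n,m\to\infty$, and $a(u_n,v)\to (y|j(v))_H$ for all $v\in D(a)$. Let $A_\infty$ be the part of $A$ in $L^\infty(X)$, that is, $D(A_\infty)=\{u\in D(A)\cap L^\infty(X): Au\in L^\infty(X)\}$ and $A_\infty u=Au$. Let $Q$ be the orthogonal projection of $H$ onto $C_\infty=\{f\in H: |f|\le 1 \text{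 a.e.}\}$, that is, $Qf=(|f|\wedge 1)\operatorname{sign} f$, where $\operatorname{sign} f=f/|f|$ where $f\neq 0$ and $\operatorname{sign} f=0$ where $f=0$. Assume that for every $u\in D(a)$ there exists $w\in D(a)$ such that $Qj(u)=j(w)$ and $\operatorname{Re} a(w,u-w)\ge 0$. Then $-A_\infty$ is m-dissipative in $L^\infty(X)$, i.e. $(0,\infty)\subset\rho(-A_\infty)$ and $\|\lambda R(\lambda,-A_\infty)\|_{\mathcal{L}(L^\infty(X))}\le 1$ for all $\lambda>0$, where $R(\lambda,-A_\infty)=(\lambda+A_\infty)^{-1}$. -/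

import Mathlib

open Filter Topology MeasureTheory
open scoped ENNReal

noncomputable section

namespace FormMethod

/-- The closed sector `{r e^{iα} : r ≥ 0, |α| ≤ θ}` in the complex plane. -/
def sector (θ : ℝ) : Set ℂ :=
  {z | ∃ r α : ℝ, 0 ≤ r ∧ |α| ≤ θ ∧ z = (r : ℂ) * Complex.exp ((α : ℂ) * Complex.I)}

/-- A sectorial form `(a, j)` in the complex inner product space `H`
(a Hilbert space in the application, where `H = L²(X)`) with form domain `V = D(a)`:
`V` is just a complex vector space (no topology), `a` is sesquilinear (linear in the first and
antilinear in the second argument), `j : V → H` is linear with dense image, and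
`a(u,u) + ω ‖j u‖²` stays in a sector of half angle `θ < π/2`. -/
structure SectorialForm (V H : Type*) [AddCommGroup V] [Module ℂ V]
    [NormedAddCommGroup H] [InnerProductSpace ℂ H] where
  /-- the sesquilinear form -/
  a : V →ₗ[ℂ] V →ₗ⋆[ℂ] ℂ
  /-- the (not necessarily injective) map into the Hilbert space -/
  j : V →ₗ[ℂ] H
  denseRange_j : DenseRange j
  sectorial : ∃ ω θ : ℝ, 0 ≤ θ ∧ θ < Real.pi / 2 ∧
    ∀ u : V, a u u + ((ω * ‖j u‖ ^ 2 : ℝ) : ℂ) ∈ sector θ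

section Operator

variable {V H : Type*} [AddCommGroup V] [Module ℂ V]
  [NormedAddCommGroup H] [InnerProductSpace ℂ H]

/-- `𝔞.Rel x y` is the relation `x ∈ D(A)` and `A x = y` for the operator `A` associated with
the form `𝔞 = (a, j)`. Mathlib's inner product is antilinear in its *first* argument, so
`inner ℂ (j v) y` is the scalar product `(y | j v)`. -/
def SectorialForm.Rel (𝔞 : SectorialForm V H) (x y : H) : Prop :=
  ∃ u : ℕ → V,
    Tendsto (fun n => 𝔞.j (u n)) atTop (𝓝 x) ∧
    Tendsto (fun p : ℕ × ℕ => 𝔞.a (u p.1 - u p.2) (u p.1 - u p.2)) atTop (𝓝 0) ∧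
    ∀ v : V, Tendsto (fun n => 𝔞.a (u n) v) atTop (𝓝 (inner ℂ (𝔞.j v) y))

/-- The real part of a sectorial form, shifted by `ω`, is nonnegative and dominates the form. -/
theorem SectorialForm.exists_bound (𝔞 : SectorialForm V H) :
    ∃ ω K : ℝ, 0 ≤ K ∧ ∀ u : V, 0 ≤ (𝔞.a u u).re + ω * ‖𝔞.j u‖ ^ 2 ∧
      ‖𝔞.a u u + ((ω * ‖𝔞.j u‖ ^ 2 : ℝ) : ℂ)‖ ≤ K * ((𝔞.a u u).re + ω * ‖𝔞.j u‖ ^ 2) := by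
  obtain ⟨ω, θ, h0, hθ, h⟩ := 𝔞.sectorial
  have hc : 0 < Real.cos θ := Real.cos_pos_of_mem_Ioo ⟨by linarith, hθ⟩
  refine ⟨ω, (Real.cos θ)⁻¹, by positivity, fun u => ?_⟩
  obtain ⟨r, α, hr, hα, hz⟩ := h u
  have hcos : Real.cos θ ≤ Real.cos α := by
    rw [← Real.cos_abs α]
    exact Real.cos_le_cos_of_nonneg_of_le_pi (abs_nonneg α) (by linarith [Real.pi_pos]) hα
  have hre : (𝔞.a u u).re + ω * ‖𝔞.j u‖ ^ 2 = r * Real.cos α := by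
    have := congrArg Complex.re hz
    rwa [Complex.add_re, Complex.ofReal_re, Complex.re_ofReal_mul,
      Complex.exp_ofReal_mul_I_re] at this
  have hn : ‖𝔞.a u u + ((ω * ‖𝔞.j u‖ ^ 2 : ℝ) : ℂ)‖ = r := by
    rw [hz, norm_mul, Complex.norm_exp_ofReal_mul_I, mul_one, Complex.norm_real,
      Real.norm_of_nonneg hr]
  rw [hre, hn]
  refine ⟨mul_nonneg hr (hc.le.trans hcos), ?_⟩
  rw [inv_mul_eq_div, le_div_iff₀ hc]
  exact mul_le_mul_of_nonneg_left hcos hr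

/-- The part of the definition of `A` that is the Cauchy condition, in terms of real parts. -/
theorem SectorialForm.tendsto_iff (𝔞 : SectorialForm V H) {ω K : ℝ}
    (hK : ∀ u : V, 0 ≤ (𝔞.a u u).re + ω * ‖𝔞.j u‖ ^ 2 ∧
      ‖𝔞.a u u + ((ω * ‖𝔞.j u‖ ^ 2 : ℝ) : ℂ)‖ ≤ K * ((𝔞.a u u).re + ω * ‖𝔞.j u‖ ^ 2))
    {u : ℕ → V} {x : H} (hx : Tendsto (fun n => 𝔞.j (u n)) atTop (𝓝 x)) :
    Tendsto (fun p : ℕ × ℕ => 𝔞.a (u p.1 - u p.2) (u p.1 - u p.2)) atTop (𝓝 0) ↔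
    Tendsto (fun p : ℕ × ℕ => (𝔞.a (u p.1 - u p.2) (u p.1 - u p.2)).re
      + ω * ‖𝔞.j (u p.1 - u p.2)‖ ^ 2) atTop (𝓝 0) := by
  have hj : Tendsto (fun p : ℕ × ℕ => ω * ‖𝔞.j (u p.1 - u p.2)‖ ^ 2) atTop (𝓝 0) := by
    rw [← prod_atTop_atTop_eq]
    have := (hx.comp tendsto_fst).sub (hx.comp (tendsto_snd (f := atTop (α := ℕ))))
    have := ((this.norm.pow 2).const_mul ω)
    simpa [Function.comp_def] using this
  constructor
  · intro h
    simpa using ((Complex.continuous_re.tendsto 0).comp h).add hj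
  · intro h
    have h1 : Tendsto (fun p : ℕ × ℕ => 𝔞.a (u p.1 - u p.2) (u p.1 - u p.2)
        + ((ω * ‖𝔞.j (u p.1 - u p.2)‖ ^ 2 : ℝ) : ℂ)) atTop (𝓝 0) :=
      squeeze_zero_norm (fun p => (hK _).2) (by simpa using h.const_mul K)
    have h2 := h1.sub ((Complex.continuous_ofReal.tendsto 0).comp hj)
    simpa [Function.comp_def] using h2

theorem SectorialForm.Rel.add {𝔞 : SectorialForm V H} {x x' y y' : H}
    (h : 𝔞.Rel x y) (h' : 𝔞.Rel x' y') : 𝔞.Rel (x + x') (y + y') := by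
  obtain ⟨ω, K, -, hK⟩ := 𝔞.exists_bound
  obtain ⟨u, h1, h2, h3⟩ := h
  obtain ⟨w, k1, k2, k3⟩ := h'
  have h4 : Tendsto (fun n => 𝔞.j (u n + w n)) atTop (𝓝 (x + x')) := by
    simpa using h1.add k1
  refine ⟨fun n => u n + w n, h4, (𝔞.tendsto_iff hK h4).2 ?_, fun v => ?_⟩
  · rw [𝔞.tendsto_iff hK h1] at h2
    rw [𝔞.tendsto_iff hK k1] at k2
    have h5 := (h2.add k2).const_mul 2
    rw [add_zero, mul_zero] at h5
    refine squeeze_zero (fun p => (hK _).1) (fun p => ?_) h5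
    have e : u p.1 + w p.1 - (u p.2 + w p.2) = (u p.1 - u p.2) + (w p.1 - w p.2) := by abel
    rw [e]
    generalize u p.1 - u p.2 = s
    generalize w p.1 - w p.2 = t
    have hp := (hK (s - t)).1
    have hq : ‖𝔞.j (s + t)‖ ^ 2 + ‖𝔞.j (s - t)‖ ^ 2 = 2 * (‖𝔞.j s‖ ^ 2 + ‖𝔞.j t‖ ^ 2) := by
      have := parallelogram_law_with_norm ℂ (𝔞.j s) (𝔞.j t)
      rw [map_add, map_sub]
      linarith
    have hr : (𝔞.a (s + t) (s + t)).re + (𝔞.a (s - t) (s - t)).re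
        = 2 * ((𝔞.a s s).re + (𝔞.a t t).re) := by
      simp only [map_add, map_sub, LinearMap.add_apply, LinearMap.sub_apply, Complex.add_re,
        Complex.sub_re]
      ring
    have hq' := congrArg (fun z => ω * z) hq
    linarith
  · simpa [inner_add_right] using (h3 v).add (k3 v)

theorem SectorialForm.Rel.smul {𝔞 : SectorialForm V H} {x y : H} (c : ℂ)
    (h : 𝔞.Rel x y) : 𝔞.Rel (c • x) (c • y) := by
  obtain ⟨u, h1, h2, h3⟩ := h
  refine ⟨fun n => c • u n, by simpa using h1.const_smul c, ?_, fun v => ?_⟩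
  · simpa only [← smul_sub, map_smul, LinearMap.smul_apply, LinearMap.map_smulₛₗ, smul_eq_mul,
      mul_zero] using (h2.const_mul c).const_mul (starRingEnd ℂ c)
  · simpa [inner_smul_right] using (h3 v).const_mul c

/-- The graph of the operator associated with a sectorial form. -/
def SectorialForm.operatorGraph (𝔞 : SectorialForm V H) : Submodule ℂ (H × H) where
  carrier := {p | 𝔞.Rel p.1 p.2}
  add_mem' h h' := h.add h'
  zero_mem' := ⟨fun _ => 0, by simp, by simp, by simp⟩
  smul_mem' c _ h := h.smul c

/-- A weighted Cauchy-Schwarz inequality for sectorial sesquilinear maps. -/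
theorem weighted_bound (b : V →ₗ[ℂ] V →ₗ⋆[ℂ] ℂ) {K : ℝ}
    (h : ∀ u, 0 ≤ (b u u).re ∧ ‖b u u‖ ≤ K * (b u u).re) (u v : V) {s : ℝ} (hs : 0 ≤ s) :
    s * ‖b u v‖ ≤ K * (s ^ 2 * (b u u).re + (b v v).re) := by
  have key : ∀ u v : V, ‖b u v‖ ≤ K * ((b u u).re + (b v v).re) := by
    intro u v
    have e : 4 * b u v = b (u + v) (u + v) - b (u - v) (u - v)
        + Complex.I * b (u + Complex.I • v) (u + Complex.I • v)
        - Complex.I * b (u - Complex.I • v) (u - Complex.I • v) := by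
      simp only [map_add, map_sub, LinearMap.add_apply, LinearMap.sub_apply, map_smul,
        LinearMap.smul_apply, LinearMap.map_smulₛₗ, smul_eq_mul, Complex.conj_I]
      linear_combination (2 * b u v - 2 * b v u) * Complex.I_mul_I
    have e2 : (b (u + v) (u + v)).re + (b (u - v) (u - v)).re
        + (b (u + Complex.I • v) (u + Complex.I • v)).re
        + (b (u - Complex.I • v) (u - Complex.I • v)).re
        = 4 * ((b u u).re + (b v v).re) := by
      simp only [map_add, map_sub, LinearMap.add_apply, LinearMap.sub_apply, map_smul,
        LinearMap.smul_apply, LinearMap.map_smulₛₗ, smul_eq_mul, Complex.conj_I,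
        Complex.add_re, Complex.sub_re, Complex.mul_re, Complex.mul_im, Complex.I_re,
        Complex.I_im, Complex.neg_re, Complex.neg_im,
        Complex.add_im, Complex.sub_im]
      ring
    have n4 : 4 * ‖b u v‖ = ‖4 * b u v‖ := by simp
    have hI : ∀ z : ℂ, ‖Complex.I * z‖ = ‖z‖ := fun z => by simp
    have tri : ‖4 * b u v‖ ≤ ‖b (u + v) (u + v)‖ + ‖b (u - v) (u - v)‖
        + ‖b (u + Complex.I • v) (u + Complex.I • v)‖
        + ‖b (u - Complex.I • v) (u - Complex.I • v)‖ := by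
      rw [e]
      refine (norm_sub_le _ _).trans ?_
      rw [hI]
      gcongr
      refine (norm_add_le _ _).trans ?_
      rw [hI]
      gcongr
      exact norm_sub_le _ _
    have e3 := congrArg (fun z => K * z) e2
    simp only [mul_add] at e3
    linarith [(h (u + v)).2, (h (u - v)).2, (h (u + Complex.I • v)).2,
      (h (u - Complex.I • v)).2]
  have := key ((s : ℂ) • u) v
  simp only [map_smul, LinearMap.smul_apply, LinearMap.map_smulₛₗ, smul_eq_mul, norm_mul,
    Complex.conj_ofReal, Complex.norm_real, Real.norm_of_nonneg hs,
    Complex.re_ofReal_mul] at this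
  linarith

/-- The operator associated with a sectorial form is well-defined. -/
theorem SectorialForm.Rel.eq_zero {𝔞 : SectorialForm V H} {y : H} (h : 𝔞.Rel 0 y) : y = 0 := by
  obtain ⟨ω, K, hK0, hK⟩ := 𝔞.exists_bound
  obtain ⟨u, h1, h2, h3⟩ := h
  rw [𝔞.tendsto_iff hK h1] at h2
  let b : V →ₗ[ℂ] V →ₗ⋆[ℂ] ℂ := LinearMap.mk₂'ₛₗ (RingHom.id ℂ) (starRingEnd ℂ)
    (fun u v => 𝔞.a u v + (ω : ℂ) * inner ℂ (𝔞.j v) (𝔞.j u))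
    (fun _ _ _ => by simp only [map_add, LinearMap.add_apply, inner_add_right]; ring)
    (fun _ _ _ => by
      simp only [map_smul, LinearMap.smul_apply, inner_smul_right, smul_eq_mul, RingHom.id_apply]
      ring)
    (fun _ _ _ => by simp only [map_add, inner_add_left]; ring)
    (fun _ _ _ => by
      simp only [map_smul, LinearMap.map_smulₛₗ, inner_smul_left, smul_eq_mul]
      ring)
  have hb : ∀ u v, b u v = 𝔞.a u v + (ω : ℂ) * inner ℂ (𝔞.j v) (𝔞.j u) := fun _ _ => rfl
  have hbb : ∀ u, b u u = 𝔞.a u u + ((ω * ‖𝔞.j u‖ ^ 2 : ℝ) : ℂ) := fun u => by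
    rw [hb, inner_self_eq_norm_sq_to_K]
    simp
  have hre : ∀ u, (b u u).re = (𝔞.a u u).re + ω * ‖𝔞.j u‖ ^ 2 := fun u => by
    rw [hbb, Complex.add_re, Complex.ofReal_re]
  have hq : ∀ u, 0 ≤ (b u u).re ∧ ‖b u u‖ ≤ (K + 1) * (b u u).re := fun u => by
    have := hK u
    rw [← hbb, ← hre] at this
    exact ⟨this.1, by linarith [this.1, this.2]⟩
  have hlim : ∀ v, Tendsto (fun n => b (u n) v) atTop (𝓝 (inner ℂ (𝔞.j v) y)) := fun v => by
    have : Tendsto (fun n => (inner ℂ (𝔞.j v) (𝔞.j (u n)) : ℂ)) atTop (𝓝 0) := by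
      simpa using (tendsto_const_nhds (x := 𝔞.j v)).inner h1
    simpa [hb] using (h3 v).add (this.const_mul (ω : ℂ))
  simp only [← hre] at h2
  have hC : ∀ x z : V,
      (b x x).re ≤ 4 * (K + 1) ^ 2 * (b (x - z) (x - z)).re + 2 * ‖b x z‖ := by
    intro x z
    have hs : (0 : ℝ) < 1 / (2 * (K + 1)) := by positivity
    have w := weighted_bound b hq x (x - z) hs.le
    have w2 : ‖b x (x - z)‖ ≤ (b x x).re / 2 + 2 * (K + 1) ^ 2 * (b (x - z) (x - z)).re := by
      have := mul_le_mul_of_nonneg_left w (show (0 : ℝ) ≤ 2 * (K + 1) by positivity)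
      have e3 : 2 * (K + 1) * (1 / (2 * (K + 1)) * ‖b x (x - z)‖) = ‖b x (x - z)‖ := by
        field_simp
      have e4 : 2 * (K + 1) * ((K + 1) * ((1 / (2 * (K + 1))) ^ 2 * (b x x).re
          + (b (x - z) (x - z)).re))
          = (b x x).re / 2 + 2 * (K + 1) ^ 2 * (b (x - z) (x - z)).re := by
        field_simp
      rwa [e3, e4] at this
    have e : b x x = b x (x - z) + b x z := by rw [map_sub]; ring
    have e' : (b x x).re = (b x (x - z)).re + (b x z).re := by
      rw [← Complex.add_re, ← e]
    linarith [Complex.re_le_norm (b x (x - z)), Complex.re_le_norm (b x z)]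
  have hy : Tendsto (fun m => ‖(inner ℂ (𝔞.j (u m)) y : ℂ)‖) atTop (𝓝 0) := by
    simpa using (h1.inner (𝕜 := ℂ) (tendsto_const_nhds (x := y))).norm
  have hzero : Tendsto (fun n => (b (u n) (u n)).re) atTop (𝓝 0) := by
    rw [Metric.tendsto_atTop]
    intro ε hε
    set δ : ℝ := ε / (4 * (K + 1) ^ 2 + 3) with hδ
    have hδ0 : 0 < δ := by positivity
    obtain ⟨⟨N, M⟩, hN⟩ := eventually_atTop.1 (h2.eventually (gt_mem_nhds hδ0))
    obtain ⟨m, hm, hmM⟩ :=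
      ((hy.eventually (gt_mem_nhds hδ0)).and (eventually_ge_atTop M)).exists
    have hn := (hlim (u m)).norm.eventually (gt_mem_nhds hm)
    obtain ⟨N', hN'⟩ := eventually_atTop.1 hn
    refine ⟨max N N', fun n hn => ?_⟩
    have a1 := hN (n, m) ⟨(le_max_left _ _).trans hn, hmM⟩
    have a2 := hN' n ((le_max_right _ _).trans hn)
    have a3 := hC (u n) (u m)
    rw [Real.dist_eq, sub_zero, abs_of_nonneg (hq _).1]
    have a4 : 4 * (K + 1) ^ 2 * (b (u n - u m) (u n - u m)).re ≤ 4 * (K + 1) ^ 2 * δ :=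
      mul_le_mul_of_nonneg_left a1.le (by positivity)
    have a5 : (4 * (K + 1) ^ 2 + 3) * δ = ε := by rw [hδ]; field_simp
    linarith
  have hin : ∀ v, (inner ℂ (𝔞.j v) y : ℂ) = 0 := by
    intro v
    by_contra hne
    have hpos : 0 < ‖(inner ℂ (𝔞.j v) y : ℂ)‖ := norm_pos_iff.2 hne
    have hle : ∀ s : ℝ, 0 ≤ s → s * ‖(inner ℂ (𝔞.j v) y : ℂ)‖ ≤ (K + 1) * (b v v).re := by
      intro s hs
      refine le_of_tendsto_of_tendsto' ((hlim v).norm.const_mul s)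
        (g := fun n => (K + 1) * (s ^ 2 * (b (u n) (u n)).re + (b v v).re)) ?_
        (fun n => weighted_bound b hq (u n) v hs)
      simpa using ((hzero.const_mul (s ^ 2)).add_const (b v v).re).const_mul (K + 1)
    have h0 : 0 ≤ (K + 1) * (b v v).re := mul_nonneg (by positivity) (hq v).1
    have := hle (((K + 1) * (b v v).re + 1) / ‖(inner ℂ (𝔞.j v) y : ℂ)‖) (by positivity)
    rw [div_mul_cancel₀ _ hpos.ne'] at this
    linarith
  refine 𝔞.denseRange_j.eq_zero_of_inner_right ℂ ?_
  exact hin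

/-- The operator `A` associated with a sectorial form. -/
def SectorialForm.operator (𝔞 : SectorialForm V H) : H →ₗ.[ℂ] H :=
  𝔞.operatorGraph.toLinearPMap

theorem SectorialForm.mem_graph_operator (𝔞 : SectorialForm V H) {x y : H} :
    (x, y) ∈ 𝔞.operator.graph ↔ 𝔞.Rel x y := by
  unfold SectorialForm.operator
  rw [Submodule.toLinearPMap_graph_eq]
  · rfl
  · rintro ⟨x, y⟩ hp (rfl : x = 0)
    exact SectorialForm.Rel.eq_zero hp

end Operator

section Part

variable {Z H : Type*} [AddCommGroup Z] [Module ℂ Z] [AddCommGroup H] [Module ℂ H]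

/-- The part of the operator `A` in a space `Z` embedded into `H` by `ι`:
its domain is `{u ∈ Z : ι u ∈ D(A), A (ι u) ∈ ι(Z)}`, and it acts as `A`. -/
def part (A : H →ₗ.[ℂ] H) (ι : Z →ₗ[ℂ] H) : Z →ₗ.[ℂ] Z :=
  (A.graph.comap (ι.prodMap ι)).toLinearPMap

theorem mem_graph_part (A : H →ₗ.[ℂ] H) (ι : Z →ₗ[ℂ] H) (hι : Function.Injective ι) {u v : Z} :
    (u, v) ∈ (part A ι).graph ↔ ∃ h : ι u ∈ A.domain, A ⟨ι u, h⟩ = ι v := by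
  unfold part
  rw [Submodule.toLinearPMap_graph_eq]
  · simp
  · rintro ⟨x, y⟩ hp (rfl : x = 0)
    have h : ((0 : H), ι y) ∈ A.graph := by simpa using hp
    exact hι (by rw [A.graph_fst_eq_zero_snd h rfl, map_zero])

end Part

section Dissipative

variable {Z : Type*} [NormedAddCommGroup Z] [NormedSpace ℂ Z]

/-- `R` is the resolvent `R(z, B) = (z - B)⁻¹`: a bounded operator on `Z` that is a two-sided
inverse of `z - B : D(B) → Z`. The point `z` belongs to the resolvent set `ρ(B)` if and only if
such an `R` exists, and `R` is then unique. -/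
def IsResolvent (B : Z →ₗ.[ℂ] Z) (z : ℂ) (R : Z →L[ℂ] Z) : Prop :=
  (∀ f : Z, ∃ h : R f ∈ B.domain, z • R f - B ⟨R f, h⟩ = f) ∧
  ∀ u : B.domain, R (z • (u : Z) - B u) = u

/-- `B` is m-dissipative: `(0,∞) ⊆ ρ(B)` and `‖l R(l, B)‖ ≤ 1` for all `l > 0`. -/
def IsMDissipative (B : Z →ₗ.[ℂ] Z) : Prop :=
  ∀ l : ℝ, 0 < l → ∃ R : Z →L[ℂ] Z, IsResolvent B (l : ℂ) R ∧ ‖(l : ℂ) • R‖ ≤ 1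

end Dissipative

section Lebesgue

variable {X : Type*} [MeasurableSpace X] (μ : Measure X)

/-- `z ↦ (|z| ∧ 1) sign z` with `sign z = z / |z|` for `z ≠ 0` and `sign 0 = 0`. -/
def truncate (z : ℂ) : ℂ := ((min ‖z‖ 1 : ℝ) : ℂ) * (z / (‖z‖ : ℂ))

theorem measurable_truncate : Measurable truncate := by
  unfold truncate
  fun_prop

theorem norm_truncate (z : ℂ) : ‖truncate z‖ = min ‖z‖ 1 := by
  rcases eq_or_ne z 0 with rfl | hz
  · simp [truncate]
  · have : ‖z‖ ≠ 0 := norm_ne_zero_iff.2 hz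
    have h0 : 0 ≤ min ‖z‖ 1 := le_min (norm_nonneg z) zero_le_one
    rw [truncate, norm_mul, norm_div, Complex.norm_real, Complex.norm_real, norm_norm,
      div_self this, mul_one, Real.norm_of_nonneg h0]

theorem memLp_truncate (f : Lp ℂ 2 μ) : MemLp (fun x => truncate (f x)) 2 μ :=
  (Lp.memLp f).of_le
    (measurable_truncate.comp_aemeasurable (Lp.aestronglyMeasurable f).aemeasurable).aestronglyMeasurable
    (Eventually.of_forall fun x => (norm_truncate (f x)).le.trans (min_le_left _ _))

/-- The map `Q f = (|f| ∧ 1) sign f` on `L²(X)`. -/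
def Q (f : Lp ℂ 2 μ) : Lp ℂ 2 μ := (memLp_truncate μ f).toLp

/-- `Q f` is the point of `C_∞ = {g ∈ L²(X) : |g| ≤ 1 a.e.}` closest to `f`, that is, `Q` is the
orthogonal projection onto `C_∞`. -/
theorem Q_isProjection (f : Lp ℂ 2 μ) : (∀ᵐ x ∂μ, ‖Q μ f x‖ ≤ 1) ∧
    ∀ g : Lp ℂ 2 μ, (∀ᵐ x ∂μ, ‖g x‖ ≤ 1) → ‖f - Q μ f‖ ≤ ‖f - g‖ := by
  have hQ : ∀ᵐ x ∂μ, Q μ f x = truncate (f x) := (memLp_truncate μ f).coeFn_toLp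
  constructor
  · filter_upwards [hQ] with x hx
    rw [hx, norm_truncate]
    exact min_le_right _ _
  · intro g hg
    refine Lp.norm_le_norm_of_ae_le ?_
    filter_upwards [hQ, hg, Lp.coeFn_sub f (Q μ f), Lp.coeFn_sub f g] with x h1 h2 h3 h4
    rw [h3, h4, Pi.sub_apply, Pi.sub_apply, h1]
    generalize f x = z at *
    rcases le_or_gt ‖z‖ 1 with hz | hz
    · have : truncate z = z := by
        rcases eq_or_ne z 0 with rfl | h0
        · simp [truncate]
        · have : (‖z‖ : ℂ) ≠ 0 := by simpa using h0
          rw [truncate, min_eq_left hz]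
          field_simp
      simp [this]
    · have h0 : (‖z‖ : ℂ) ≠ 0 := by
        have : ‖z‖ ≠ 0 := by linarith
        exact_mod_cast this
      have e : z - truncate z = ((1 - 1 / ‖z‖ : ℝ) : ℂ) * z := by
        rw [truncate, min_eq_right hz.le]
        push_cast
        field_simp
      have hp : (0 : ℝ) ≤ 1 - 1 / ‖z‖ := by
        rw [sub_nonneg, div_le_one (by linarith)]
        exact hz.le
      have : ‖z - truncate z‖ = ‖z‖ - 1 := by
        rw [e, norm_mul, Complex.norm_real, Real.norm_of_nonneg hp]
        have : ‖z‖ ≠ 0 := by linarith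
        field_simp
      linarith [norm_sub_norm_le z (g x)]

/-- The embedding of `L^∞(X)` into `L²(X)` for a finite measure. -/
def linftyToL2 [IsFiniteMeasure μ] : Lp ℂ ∞ μ →ₗ[ℂ] Lp ℂ 2 μ where
  toFun f := ⟨f.1, Lp.antitone le_top f.2⟩
  map_add' _ _ := rfl
  map_smul' _ _ := rfl

theorem linftyToL2_injective [IsFiniteMeasure μ] : Function.Injective (linftyToL2 μ) :=
  fun f g h => Subtype.ext (show f.1 = g.1 from congrArg (fun k : Lp ℂ 2 μ => k.1) h)

end Lebesgue

end FormMethod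

end
/-
For `ω` with `a + ω (j | j)` sectorial and `l > ω`, the Lax-Milgram lemma in the completion of
`D(a)` solves `l x + A x = l f`. If `|f| ≤ 1`, testing the approximating sequence `u_n` of `x`
against `u_n - w_n`, where `j(w_n) = Q j(u_n)`, gives
`Re (a + l)(u_n - w_n, u_n - w_n) ≤ Re ((a + l)(u_n, u_n - w_n) - (l f | j(u_n - w_n)))`,
since both `Re a(w_n, u_n - w_n)` and the obtuse angle term of the projection are nonnegative.
The right-hand side is `o(1)` times the form norm of `u_n - w_n`, so `j(u_n) - Q j(u_n) → 0` and
`|x| ≤ 1`. By scaling, `l + A_∞` is onto and `l ‖u‖ ≤ ‖l u + A_∞ u‖` for all large `l`; the bound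
passes to smaller `l` by the triangle inequality and surjectivity by the Neumann series.
-/

noncomputable section

namespace FormMethod

section LaxMilgram

open UniformSpace (Completion)

variable {𝕜 : Type*} [RCLike 𝕜]

theorem exists_apply_eq_of_coercive {W : Type*} [NormedAddCommGroup W] [InnerProductSpace 𝕜 W]
    [CompleteSpace W] (B : W →L⋆[𝕜] W →L[𝕜] 𝕜) {c : NNReal} (hc : 0 < c)
    (hB : ∀ u, ‖u‖ ^ 2 * c ≤ ‖B u u‖) (φ : W →L[𝕜] 𝕜) : ∃ u, B u = φ := by
  let T := InnerProductSpace.continuousLinearMapOfBilin B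
  have inner_T : ∀ u v, inner 𝕜 (T u) v = B u v :=
    InnerProductSpace.continuousLinearMapOfBilin_apply B
  have isUnit_T : IsUnit T :=
    T.isUnit_of_forall_le_norm_inner_map hc fun u => by simpa only [inner_T] using hB u
  obtain ⟨u, hu⟩ := (T.isUnit_iff_bijective.1 isUnit_T).surjective
    ((InnerProductSpace.toDual 𝕜 W).symm φ)
  refine ⟨u, ContinuousLinearMap.ext fun v => ?_⟩
  rw [← inner_T, hu, InnerProductSpace.toDual_symm_apply]

theorem extend_toComplL_coe {σ : 𝕜 →+* 𝕜} {V F : Type*} [SeminormedAddCommGroup V]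
    [NormedSpace 𝕜 V] [AddCommGroup F] [UniformSpace F] [IsUniformAddGroup F] [T0Space F]
    [Module 𝕜 F] [ContinuousConstSMul 𝕜 F] [CompleteSpace F]
    (T : V →SL[σ] F) (v : V) : T.extend (Completion.toComplL (𝕜 := 𝕜)) (v : Completion V) = T v :=
  T.extend_eq (e := Completion.toComplL) Completion.denseRange_coe
    (Completion.isUniformInducing_coe V) v

theorem exists_extension_completion {V : Type*} [SeminormedAddCommGroup V] [NormedSpace 𝕜 V]
    (B : V →L⋆[𝕜] V →L[𝕜] 𝕜) :
    ∃ B' : Completion V →L⋆[𝕜] Completion V →L[𝕜] 𝕜, ∀ u v : V, B' u v = B u v := by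
  let B₁ : V →L[𝕜] Completion V →L⋆[𝕜] 𝕜 := (B.extend (Completion.toComplL (𝕜 := 𝕜))).flip
  refine ⟨(B₁.extend (Completion.toComplL (𝕜 := 𝕜))).flip, fun u v => ?_⟩
  simp only [B₁, ContinuousLinearMap.flip_apply, extend_toComplL_coe]

theorem exists_cauchySeq_tendsto_of_coercive {V : Type*} [SeminormedAddCommGroup V]
    [InnerProductSpace 𝕜 V] (B : V →L⋆[𝕜] V →L[𝕜] 𝕜) {c : NNReal} (hc : 0 < c)
    (hB : ∀ u, ‖u‖ ^ 2 * c ≤ ‖B u u‖) (φ : V →L[𝕜] 𝕜) :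
    ∃ u : ℕ → V, CauchySeq u ∧ ∀ v, Tendsto (fun n => B (u n) v) atTop (𝓝 (φ v)) := by
  obtain ⟨B', hB'⟩ := exists_extension_completion B
  have coercive_B' : ∀ w, ‖w‖ ^ 2 * c ≤ ‖B' w w‖ := fun w =>
    Completion.induction_on w (isClosed_le (by fun_prop) (by fun_prop)) fun v => by
      simpa only [Completion.norm_coe, hB'] using hB v
  obtain ⟨w, hw⟩ := exists_apply_eq_of_coercive B' hc coercive_B'
    (φ.extend (Completion.toComplL (𝕜 := 𝕜)))
  obtain ⟨u, hu⟩ : ∃ u : ℕ → V, Tendsto (fun n => (u n : Completion V)) atTop (𝓝 w) := by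
    obtain ⟨z, hz, hzw⟩ := mem_closure_iff_seq_limit.1 (Completion.denseRange_coe w)
    choose u hu using hz
    exact ⟨u, by simpa only [hu] using hzw⟩
  refine ⟨u, ?_, fun v => ?_⟩
  · exact (Completion.isUniformInducing_coe V).cauchy_map_iff.1 hu.cauchySeq
  · have tendsto_B' := ((ContinuousLinearMap.apply 𝕜 𝕜 (v : Completion V)).continuous.comp
      B'.continuous).tendsto w |>.comp hu
    simpa only [Function.comp_def, ContinuousLinearMap.apply_apply, hB', hw,
      extend_toComplL_coe] using tendsto_B'

end LaxMilgram

section Sectorial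

variable {V : Type*} [AddCommGroup V] [Module ℂ V]

/-- The sesquilinear map `b` takes its values `b u u` in a sector with vertex `0` and half angle
less than `π / 2`. The angle is encoded by the constant `K`, which bounds its secant. -/
structure IsSectorial (b : V →ₗ[ℂ] V →ₗ⋆[ℂ] ℂ) (K : ℝ) : Prop where
  const_nonneg : 0 ≤ K
  re_nonneg (u : V) : 0 ≤ (b u u).re
  norm_self_le (u : V) : ‖b u u‖ ≤ K * (b u u).re

/-- The sequence `u` is Cauchy for the seminorm `u ↦ (Re b(u,u))^(1/2)` of a sectorial `b`. -/
def IsFormCauchy (b : V →ₗ[ℂ] V →ₗ⋆[ℂ] ℂ) (u : ℕ → V) : Prop :=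
  Tendsto (fun p : ℕ × ℕ => (b (u p.1 - u p.2) (u p.1 - u p.2)).re) atTop (𝓝 0)

namespace IsSectorial

variable {b : V →ₗ[ℂ] V →ₗ⋆[ℂ] ℂ} {K : ℝ}

theorem norm_apply_le (hb : IsSectorial b K) (u v : V) :
    ‖b u v‖ ≤ 2 * K * √(b u u).re * √(b v v).re := by
  have quadratic_nonneg : ∀ s : ℝ,
      0 ≤ K * (b u u).re * (s * s) + -‖b u v‖ * s + K * (b v v).re := fun s => by
    rcases le_total 0 s with hs | hs
    · linarith [weighted_bound b (fun w => ⟨hb.re_nonneg w, hb.norm_self_le w⟩) u v hs]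
    · have hu := mul_nonneg hb.const_nonneg (hb.re_nonneg u)
      have hv := mul_nonneg hb.const_nonneg (hb.re_nonneg v)
      linarith [mul_nonneg hu (mul_self_nonneg s),
        mul_nonneg (norm_nonneg (b u v)) (neg_nonneg.2 hs)]
  have discrim_nonpos := discrim_le_zero quadratic_nonneg
  rw [mul_assoc, ← Real.sqrt_mul (hb.re_nonneg u)]
  have hK := hb.const_nonneg
  refine abs_le_of_sq_le_sq' ?_ (by positivity) |>.2
  rw [mul_pow, Real.sq_sqrt (mul_nonneg (hb.re_nonneg u) (hb.re_nonneg v))]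
  unfold discrim at discrim_nonpos
  linarith

theorem eventually_norm_sub_le (hb : IsSectorial b K) {u : ℕ → V} (hu : IsFormCauchy b u)
    {φ : V → ℂ} (hφ : ∀ v, Tendsto (fun n => b (u n) v) atTop (𝓝 (φ v))) {ε : ℝ} (hε : 0 < ε) :
    ∀ᶠ n in atTop, ∀ v, ‖b (u n) v - φ v‖ ≤ ε * √(b v v).re := by
  have sqrt_cauchy : Tendsto
      (fun p : ℕ × ℕ => 2 * K * √(b (u p.1 - u p.2) (u p.1 - u p.2)).re) atTop (𝓝 0) := by
    simpa using hu.sqrt.const_mul (2 * K)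
  rw [← prod_atTop_atTop_eq] at sqrt_cauchy
  filter_upwards [(sqrt_cauchy.eventually_le_const hε).curry] with n hn v
  refine le_of_tendsto (tendsto_const_nhds.sub (hφ v)).norm ?_
  filter_upwards [hn] with m hm
  calc ‖b (u n) v - b (u m) v‖ = ‖b (u n - u m) v‖ := by rw [map_sub, LinearMap.sub_apply]
    _ ≤ 2 * K * √(b (u n - u m) (u n - u m)).re * √(b v v).re := hb.norm_apply_le _ _
    _ ≤ ε * √(b v v).re := mul_le_mul_of_nonneg_right hm (Real.sqrt_nonneg _)

/-- The pre-inner product given by the Hermitian part of `b`, so that `‖u‖² = Re b(u,u)`. -/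
@[reducible]
def preInnerProductSpaceCore (hb : IsSectorial b K) : PreInnerProductSpace.Core ℂ V where
  inner u v := (starRingEnd ℂ (b u v) + b v u) / 2
  conj_inner_symm u v := by simp [add_comm, Complex.conj_ofNat]
  re_inner_nonneg u := by simpa using hb.re_nonneg u
  add_left u v w := by simp only [map_add, LinearMap.add_apply]; ring
  smul_left u v c := by
    simp only [map_smul, LinearMap.map_smulₛₗ, LinearMap.smul_apply, smul_eq_mul, map_mul]; ring

theorem exists_isFormCauchy_tendsto (hb : IsSectorial b K) (φ : V →ₗ⋆[ℂ] ℂ) {M : ℝ}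
    (hφ : ∀ v, ‖φ v‖ ≤ M * √(b v v).re) :
    ∃ u : ℕ → V, IsFormCauchy b u ∧ ∀ v, Tendsto (fun n => b (u n) v) atTop (𝓝 (φ v)) := by
  let _ : PreInnerProductSpace.Core ℂ V := hb.preInnerProductSpaceCore
  let _ : SeminormedAddCommGroup V :=
    InnerProductSpace.Core.toSeminormedAddCommGroup (𝕜 := ℂ) (F := V)
  let _ : InnerProductSpace ℂ V := InnerProductSpace.ofCore hb.preInnerProductSpaceCore
  have norm_eq : ∀ u : V, ‖u‖ = √(b u u).re := fun u => by
    rw [norm_eq_sqrt_re_inner (𝕜 := ℂ)]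
    change √((starRingEnd ℂ (b u u) + b u u) / 2).re = _
    simp
  have norm_sq_eq : ∀ u : V, ‖u‖ ^ 2 = (b u u).re := fun u => by
    rw [norm_eq, Real.sq_sqrt (hb.re_nonneg u)]
  let B : V →L⋆[ℂ] V →L[ℂ] ℂ := LinearMap.mkContinuous₂
    (LinearMap.mk₂'ₛₗ (starRingEnd ℂ) (RingHom.id ℂ) (fun u v => starRingEnd ℂ (b u v))
      (fun _ _ _ => by simp) (fun _ _ _ => by simp) (fun _ _ _ => by simp)
      (fun _ _ _ => by simp))
    (2 * K) (fun u v => by simpa [norm_eq] using hb.norm_apply_le u v)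
  let Φ : V →L[ℂ] ℂ := LinearMap.mkContinuous
    { toFun := fun v => starRingEnd ℂ (φ v)
      map_add' := fun _ _ => by simp
      map_smul' := fun _ _ => by simp }
    M (fun v => by simpa [norm_eq] using hφ v)
  have coercive : ∀ u, ‖u‖ ^ 2 * (1 : NNReal) ≤ ‖B u u‖ := fun u => by
    simpa [B, norm_sq_eq] using Complex.re_le_norm (b u u)
  obtain ⟨u, cauchy_u, hu⟩ := exists_cauchySeq_tendsto_of_coercive B one_pos coercive Φ
  refine ⟨u, ?_, fun v => ?_⟩
  · simpa [IsFormCauchy, dist_eq_norm, norm_sq_eq] using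
      (cauchySeq_iff_tendsto_dist_atTop_0.1 cauchy_u).pow 2
  · simpa [B, Φ, Function.comp_def] using (Complex.continuous_conj.tendsto _).comp (hu v)

end IsSectorial

end Sectorial

section Shift

variable {V H : Type*} [AddCommGroup V] [Module ℂ V]
  [NormedAddCommGroup H] [InnerProductSpace ℂ H]

namespace SectorialForm

/-- The shifted form `a(u,v) + l (j(u) | j(v))`, which belongs to the operator `A + l`. -/
def shift (𝔞 : SectorialForm V H) (l : ℝ) : V →ₗ[ℂ] V →ₗ⋆[ℂ] ℂ :=
  𝔞.a + (l : ℂ) • ((innerₛₗ ℂ ∘ₛₗ 𝔞.j).flip ∘ₗ 𝔞.j)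

variable (𝔞 : SectorialForm V H) {l ω K : ℝ}

theorem shift_apply (l : ℝ) (u v : V) :
    𝔞.shift l u v = 𝔞.a u v + (l : ℂ) * inner ℂ (𝔞.j v) (𝔞.j u) := rfl

theorem shift_self (l : ℝ) (u : V) :
    𝔞.shift l u u = 𝔞.a u u + ((l * ‖𝔞.j u‖ ^ 2 : ℝ) : ℂ) := by
  rw [shift_apply, inner_self_eq_norm_sq_to_K]
  simp

theorem re_shift_self (l : ℝ) (u : V) :
    (𝔞.shift l u u).re = (𝔞.a u u).re + l * ‖𝔞.j u‖ ^ 2 := by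
  rw [shift_self, Complex.add_re, Complex.ofReal_re]

theorem exists_isSectorial_shift : ∃ ω K : ℝ, IsSectorial (𝔞.shift ω) K := by
  obtain ⟨ω, K, hK, bound⟩ := 𝔞.exists_bound
  exact ⟨ω, K, hK, fun u => by simpa only [re_shift_self] using (bound u).1,
    fun u => by simpa only [shift_self, Complex.add_re, Complex.ofReal_re] using (bound u).2⟩

variable {𝔞}

theorem mul_sq_norm_j_le_re_shift (h : IsSectorial (𝔞.shift ω) K) (l : ℝ) (u : V) :
    (l - ω) * ‖𝔞.j u‖ ^ 2 ≤ (𝔞.shift l u u).re := by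
  have := h.re_nonneg u
  rw [re_shift_self] at this ⊢
  linarith

theorem norm_j_le (h : IsSectorial (𝔞.shift ω) K) (hl : ω < l) (u : V) :
    ‖𝔞.j u‖ ≤ √(l - ω)⁻¹ * √(𝔞.shift l u u).re := by
  rw [← Real.sqrt_mul (inv_nonneg.2 (sub_nonneg.2 hl.le))]
  refine Real.le_sqrt_of_sq_le ?_
  rw [le_inv_mul_iff₀ (sub_pos.2 hl)]
  exact mul_sq_norm_j_le_re_shift h l u

theorem isSectorial_shift_of_le (h : IsSectorial (𝔞.shift ω) K) (hl : ω ≤ l) :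
    IsSectorial (𝔞.shift l) (K + 1) := by
  have sq_nonneg (u : V) : 0 ≤ (l - ω) * ‖𝔞.j u‖ ^ 2 :=
    mul_nonneg (sub_nonneg.2 hl) (pow_nonneg (norm_nonneg _) 2)
  have shift_eq (u : V) :
      𝔞.shift l u u = 𝔞.shift ω u u + (((l - ω) * ‖𝔞.j u‖ ^ 2 : ℝ) : ℂ) := by
    rw [shift_self, shift_self]
    push_cast
    ring
  refine ⟨by linarith [h.const_nonneg],
    fun u => (sq_nonneg u).trans (mul_sq_norm_j_le_re_shift h l u), fun u => ?_⟩
  rw [shift_eq, Complex.add_re, Complex.ofReal_re]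
  calc ‖𝔞.shift ω u u + (((l - ω) * ‖𝔞.j u‖ ^ 2 : ℝ) : ℂ)‖
      ≤ K * (𝔞.shift ω u u).re + (l - ω) * ‖𝔞.j u‖ ^ 2 :=
        norm_add_le_of_le (h.norm_self_le u) (Complex.norm_of_nonneg (sq_nonneg u)).le
    _ ≤ (K + 1) * ((𝔞.shift ω u u).re + (l - ω) * ‖𝔞.j u‖ ^ 2) := by
        linarith [h.re_nonneg u, mul_nonneg h.const_nonneg (sq_nonneg u)]

theorem rel_iff_shift (h : IsSectorial (𝔞.shift l) K) {x y : H} :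
    𝔞.Rel x y ↔ ∃ u : ℕ → V, Tendsto (fun n => 𝔞.j (u n)) atTop (𝓝 x) ∧
      IsFormCauchy (𝔞.shift l) u ∧
      ∀ v, Tendsto (fun n => 𝔞.shift l (u n) v) atTop (𝓝 (inner ℂ (𝔞.j v) (y + (l : ℂ) • x))) := by
  have bound (u : V) := And.intro (h.re_nonneg u) (h.norm_self_le u)
  simp only [shift_self, Complex.add_re, Complex.ofReal_re] at bound
  refine exists_congr fun u => and_congr_right fun hx =>
    and_congr ?_ (forall_congr' fun v => ?_)
  · simpa only [IsFormCauchy, re_shift_self] using 𝔞.tendsto_iff bound hx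
  · have tendsto_inner : Tendsto (fun n => (l : ℂ) * inner ℂ (𝔞.j v) (𝔞.j (u n))) atTop
        (𝓝 (l * inner ℂ (𝔞.j v) x)) := (tendsto_const_nhds.inner hx).const_mul _
    simp only [shift_apply, inner_add_right, inner_smul_right]
    exact ⟨fun hy => hy.add tendsto_inner, fun hy => by simpa using hy.sub tendsto_inner⟩

theorem exists_rel_sub_smul [CompleteSpace H] (h : IsSectorial (𝔞.shift ω) K) (hl : ω < l)
    (f : H) : ∃ x, 𝔞.Rel x (f - (l : ℂ) • x) := by
  have sectorial_l := isSectorial_shift_of_le h hl.le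
  let φ : V →ₗ⋆[ℂ] ℂ := (innerₛₗ ℂ).flip f ∘ₛₗ 𝔞.j
  have φ_le (v : V) : ‖φ v‖ ≤ √(l - ω)⁻¹ * ‖f‖ * √(𝔞.shift l v v).re :=
    calc ‖inner ℂ (𝔞.j v) f‖ ≤ ‖𝔞.j v‖ * ‖f‖ := norm_inner_le_norm _ _
      _ ≤ √(l - ω)⁻¹ * √(𝔞.shift l v v).re * ‖f‖ := by gcongr; exact norm_j_le h hl v
      _ = √(l - ω)⁻¹ * ‖f‖ * √(𝔞.shift l v v).re := by ring
  obtain ⟨u, cauchy_u, hu⟩ := sectorial_l.exists_isFormCauchy_tendsto φ φ_le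
  have cauchySeq_j : CauchySeq fun n => 𝔞.j (u n) := by
    refine cauchySeq_iff_tendsto_dist_atTop_0.2 ?_
    simp only [dist_eq_norm, ← map_sub]
    exact squeeze_zero (fun _ => norm_nonneg _) (fun _ => norm_j_le h hl _)
      (by simpa using cauchy_u.sqrt.const_mul √(l - ω)⁻¹)
  obtain ⟨x, hx⟩ := cauchySeq_tendsto_of_complete cauchySeq_j
  exact ⟨x, (rel_iff_shift sectorial_l).2
    ⟨u, hx, cauchy_u, fun v => by rw [sub_add_cancel]; exact hu v⟩⟩

end SectorialForm

end Shift

section Invariance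

/-- `P` maps each point of `E` to a point of `C` nearest to it. -/
def IsMetricProjection {E : Type*} [NormedAddCommGroup E] (P : E → E) (C : Set E) : Prop :=
  ∀ g, P g ∈ C ∧ ∀ f ∈ C, ‖g - P g‖ ≤ ‖g - f‖

namespace IsMetricProjection

variable {H : Type*} [NormedAddCommGroup H] {P : H → H} {C : Set H}

theorem mem_of_tendsto (hP : IsMetricProjection P C) {g : ℕ → H} {x : H}
    (hx : Tendsto (fun n => P (g n)) atTop (𝓝 x)) : x ∈ C := by
  have norm_sub_nonpos : ‖x - P x‖ ≤ ‖x - x‖ :=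
    ge_of_tendsto' (tendsto_const_nhds.sub hx).norm fun n => (hP x).2 _ (hP (g n)).1
  rw [sub_self, norm_zero, norm_le_zero_iff, sub_eq_zero] at norm_sub_nonpos
  exact norm_sub_nonpos ▸ (hP x).1

theorem re_inner_sub_nonneg [InnerProductSpace ℂ H] (hP : IsMetricProjection P C)
    (hC : Convex ℝ C) (g : H) {f : H} (hf : f ∈ C) :
    0 ≤ (inner ℂ (g - P g) (P g - f)).re := by
  let _ : InnerProductSpace ℝ H := InnerProductSpace.complexToReal
  have : Nonempty C := ⟨P g, (hP g).1⟩
  have bddBelow_range : BddBelow (Set.range fun w : C => ‖g - w‖) :=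
    ⟨0, Set.forall_mem_range.2 fun _ => norm_nonneg _⟩
  have norm_eq_iInf : ‖g - P g‖ = ⨅ w : C, ‖g - w‖ :=
    le_antisymm (le_ciInf fun w => (hP g).2 w w.2)
      (ciInf_le bddBelow_range ⟨P g, (hP g).1⟩)
  have obtuse := (norm_eq_iInf_iff_real_inner_le_zero hC (hP g).1).1 norm_eq_iInf f hf
  rw [← neg_sub f, inner_neg_right, Complex.neg_re, Left.nonneg_neg_iff]
  exact obtuse

end IsMetricProjection

variable {V H : Type*} [AddCommGroup V] [Module ℂ V]
  [NormedAddCommGroup H] [InnerProductSpace ℂ H]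

namespace SectorialForm

variable {𝔞 : SectorialForm V H} {l ω K : ℝ}

theorem re_shift_sub_le {P : H → H} {C : Set H} (hP : IsMetricProjection P C) (hC : Convex ℝ C)
    (hl : 0 ≤ l) {u w : V} (hw : P (𝔞.j u) = 𝔞.j w) (ha : 0 ≤ (𝔞.a w (u - w)).re) {f : H}
    (hf : f ∈ C) :
    (𝔞.shift l (u - w) (u - w)).re ≤
      (𝔞.shift l u (u - w) - inner ℂ (𝔞.j (u - w)) ((l : ℂ) • f)).re := by
  have obtuse := hP.re_inner_sub_nonneg hC (𝔞.j u) hf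
  rw [hw, ← map_sub] at obtuse
  have split : 𝔞.shift l u (u - w) - inner ℂ (𝔞.j (u - w)) ((l : ℂ) • f)
      = 𝔞.shift l (u - w) (u - w) + 𝔞.a w (u - w)
        + l * inner ℂ (𝔞.j (u - w)) (𝔞.j w - f) := by
    rw [map_sub (𝔞.shift l) u w, LinearMap.sub_apply, 𝔞.shift_apply l w, inner_sub_right,
      inner_smul_right]
    ring
  rw [split, Complex.add_re, Complex.add_re, Complex.re_ofReal_mul]
  linarith [mul_nonneg hl obtuse]

theorem mem_of_rel_of_isMetricProjection (h : IsSectorial (𝔞.shift ω) K) (hωl : ω < l)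
    (hl : 0 ≤ l) {P : H → H} {C : Set H} (hP : IsMetricProjection P C) (hC : Convex ℝ C)
    (hinv : ∀ u, ∃ w, P (𝔞.j u) = 𝔞.j w ∧ 0 ≤ (𝔞.a w (u - w)).re) {x f : H} (hf : f ∈ C)
    (hx : 𝔞.Rel x ((l : ℂ) • (f - x))) : x ∈ C := by
  have sectorial_l := isSectorial_shift_of_le h hωl.le
  obtain ⟨u, hux, cauchy_u, hu⟩ := (rel_iff_shift sectorial_l).1 hx
  rw [smul_sub, sub_add_cancel] at hu
  choose w hw ha using fun n => hinv (u n)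
  let q : V → ℝ := fun v => √(𝔞.shift l v v).re
  have q_sq (v : V) : q v ^ 2 = (𝔞.shift l v v).re := Real.sq_sqrt (sectorial_l.re_nonneg v)
  have q_tendsto : Tendsto (fun n => q (u n - w n)) atTop (𝓝 0) := by
    refine tendsto_order.2 ⟨fun _ hc => .of_forall fun _ => hc.trans_le (Real.sqrt_nonneg _),
      fun ε hε => ?_⟩
    filter_upwards [sectorial_l.eventually_norm_sub_le cauchy_u hu (half_pos hε)] with n hn
    have q_sq_le : q (u n - w n) ^ 2 ≤ ε / 2 * q (u n - w n) :=
      calc q (u n - w n) ^ 2 = (𝔞.shift l (u n - w n) (u n - w n)).re := q_sq _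
        _ ≤ (𝔞.shift l (u n) (u n - w n) - inner ℂ (𝔞.j (u n - w n)) ((l : ℂ) • f)).re :=
          re_shift_sub_le hP hC hl (hw n) (ha n) hf
        _ ≤ ε / 2 * q (u n - w n) := (Complex.re_le_norm _).trans (hn _)
    nlinarith
  have sub_tendsto : Tendsto (fun n => 𝔞.j (u n - w n)) atTop (𝓝 0) :=
    squeeze_zero_norm (fun n => norm_j_le h hωl _)
      (by simpa only [mul_zero] using q_tendsto.const_mul √(l - ω)⁻¹)
  refine hP.mem_of_tendsto (g := fun n => 𝔞.j (u n)) ?_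
  simpa [hw] using hux.sub sub_tendsto

end SectorialForm

end Invariance

section Resolvent

variable {Z : Type*} [NormedAddCommGroup Z] [NormedSpace ℂ Z] {B : Z →ₗ.[ℂ] Z} {l L : ℝ}

theorem exists_isResolvent (hl : 0 < l)
    (surj : ∀ f : Z, ∃ u : B.domain, (l : ℂ) • (u : Z) - B u = f)
    (dissipative : ∀ u : B.domain, l * ‖(u : Z)‖ ≤ ‖(l : ℂ) • (u : Z) - B u‖) :
    ∃ R : Z →L[ℂ] Z, IsResolvent B (l : ℂ) R ∧ ‖(l : ℂ) • R‖ ≤ 1 := by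
  let T : B.domain →ₗ[ℂ] Z := (l : ℂ) • B.domain.subtype - B.toFun
  have injective_T : Function.Injective T := by
    refine (injective_iff_map_eq_zero T).2 fun u hu => ?_
    have norm_nonpos : l * ‖(u : Z)‖ ≤ 0 := (dissipative u).trans (norm_le_zero_iff.2 hu)
    exact Subtype.ext (norm_le_zero_iff.1 (nonpos_of_mul_nonpos_right norm_nonpos hl))
  let E := LinearEquiv.ofBijective T ⟨injective_T, surj⟩
  have sub_E_symm (f : Z) : (l : ℂ) • (E.symm f : Z) - B (E.symm f) = f := E.apply_symm_apply f
  have norm_E_symm_le (f : Z) : l * ‖(E.symm f : Z)‖ ≤ ‖f‖ := by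
    simpa only [sub_E_symm] using dissipative (E.symm f)
  let R : Z →L[ℂ] Z := (B.domain.subtype ∘ₗ E.symm.toLinearMap).mkContinuous l⁻¹ fun f =>
    (le_inv_mul_iff₀ hl).2 (norm_E_symm_le f)
  refine ⟨R, ⟨fun f => ⟨(E.symm f).2, sub_E_symm f⟩,
    fun u => congrArg Subtype.val (E.symm_apply_apply u)⟩, ?_⟩
  refine ContinuousLinearMap.opNorm_le_bound _ zero_le_one fun f => ?_
  rw [smul_apply, norm_smul, Complex.norm_of_nonneg hl.le, one_mul]
  exact norm_E_symm_le f

theorem smul_sub_eq_add_smul (u : B.domain) :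
    (L : ℂ) • (u : Z) - B u = ((l : ℂ) • (u : Z) - B u) + ((L - l : ℝ) : ℂ) • (u : Z) := by
  rw [Complex.ofReal_sub, sub_smul]
  abel

theorem mul_norm_le_norm_smul_sub_of_le {u : B.domain} (hlL : l ≤ L)
    (dissipative : L * ‖(u : Z)‖ ≤ ‖(L : ℂ) • (u : Z) - B u‖) :
    l * ‖(u : Z)‖ ≤ ‖(l : ℂ) • (u : Z) - B u‖ := by
  rw [smul_sub_eq_add_smul (l := l)] at dissipative
  have := dissipative.trans (norm_add_le _ _)
  rw [norm_smul, Complex.norm_of_nonneg (sub_nonneg.2 hlL)] at this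
  linarith

theorem exists_smul_sub_eq_of_lt [CompleteSpace Z] (hl : 0 < l) (hlL : l < L) {R : Z →L[ℂ] Z}
    (hR : IsResolvent B (L : ℂ) R) (norm_le : ‖(L : ℂ) • R‖ ≤ 1) (f : Z) :
    ∃ u : B.domain, (l : ℂ) • (u : Z) - B u = f := by
  have norm_lt_one : ‖((L - l : ℝ) : ℂ) • R‖ < 1 := by
    have hL := hl.trans hlL
    rw [norm_smul, Complex.norm_of_nonneg (sub_pos.2 hlL).le]
    rw [norm_smul, Complex.norm_of_nonneg hL.le, ← le_inv_mul_iff₀ hL, mul_one] at norm_le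
    calc (L - l) * ‖R‖ ≤ (L - l) * L⁻¹ := by gcongr
      _ < L * L⁻¹ := by gcongr; linarith
      _ = 1 := mul_inv_cancel₀ hL.ne'
  obtain ⟨S, hS⟩ := isUnit_one_sub_of_norm_lt_one norm_lt_one
  let g : Z := (↑S⁻¹ : Z →L[ℂ] Z) f
  have sub_eq : g - ((L - l : ℝ) : ℂ) • R g = f := by
    have := DFunLike.congr_fun S.mul_inv f
    rwa [hS] at this
  obtain ⟨mem_domain, hg⟩ := hR.1 g
  have split := smul_sub_eq_add_smul (l := l) (L := L) ⟨R g, mem_domain⟩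
  rw [hg] at split
  exact ⟨⟨R g, mem_domain⟩, (eq_sub_of_add_eq split.symm).trans sub_eq⟩

theorem isMDissipative_of_eventually [CompleteSpace Z]
    (h : ∀ᶠ l : ℝ in atTop, (∀ f : Z, ∃ u : B.domain, (l : ℂ) • (u : Z) - B u = f) ∧
      ∀ u : B.domain, l * ‖(u : Z)‖ ≤ ‖(l : ℂ) • (u : Z) - B u‖) : IsMDissipative B := by
  intro l hl
  obtain ⟨L, ⟨surj, dissipative⟩, hlL⟩ := (h.and (eventually_gt_atTop l)).exists
  obtain ⟨R, hR, norm_le⟩ := exists_isResolvent (hl.trans hlL) surj dissipative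
  exact exists_isResolvent hl (exists_smul_sub_eq_of_lt hl hlL hR norm_le)
    fun u => mul_norm_le_norm_smul_sub_of_le hlL.le (dissipative u)

end Resolvent

section Lebesgue

variable {X : Type*} [MeasurableSpace X] {μ : Measure X}

theorem ae_norm_coe_smul_le_iff {p : ℝ≥0∞} {c : ℂ} {f : Lp ℂ p μ} {r : ℝ} :
    (∀ᵐ x ∂μ, ‖(c • f : Lp ℂ p μ) x‖ ≤ r) ↔ ∀ᵐ x ∂μ, ‖c‖ * ‖f x‖ ≤ r :=
  eventually_congr <| (Lp.coeFn_smul c f).mono fun x hx => by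
    rw [hx, Pi.smul_apply, norm_smul]

theorem convex_setOf_ae_norm_le {p : ℝ≥0∞} (r : ℝ) :
    Convex ℝ {f : Lp ℂ p μ | ∀ᵐ x ∂μ, ‖f x‖ ≤ r} := by
  intro f hf g hg a b ha hb hab
  change ∀ᵐ x ∂μ, ‖((a : ℂ) • f + (b : ℂ) • g : Lp ℂ p μ) x‖ ≤ r
  filter_upwards [hf, hg, Lp.coeFn_add ((a : ℂ) • f) ((b : ℂ) • g), Lp.coeFn_smul (a : ℂ) f,
    Lp.coeFn_smul (b : ℂ) g] with x hfx hgx coeFn_add coeFn_smul_f coeFn_smul_g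
  rw [coeFn_add, Pi.add_apply, coeFn_smul_f, coeFn_smul_g]
  exact mem_closedBall_zero_iff.1 <| convex_closedBall (0 : ℂ) r
    (mem_closedBall_zero_iff.2 hfx) (mem_closedBall_zero_iff.2 hgx) ha hb hab

theorem isMetricProjection_Q :
    IsMetricProjection (Q μ) {f : Lp ℂ 2 μ | ∀ᵐ x ∂μ, ‖f x‖ ≤ 1} :=
  Q_isProjection μ

theorem ae_norm_le_norm_linfty (f : Lp ℂ ∞ μ) : ∀ᵐ x ∂μ, ‖f x‖ ≤ ‖f‖ := by
  simpa only [Lp.norm_def, toReal_eLpNorm (Lp.aestronglyMeasurable f)] using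
    ae_le_lpNorm_exponent_top (Lp.memLp f)

theorem norm_linfty_le {f : Lp ℂ ∞ μ} {M : ℝ} (hM : 0 ≤ M) (h : ∀ᵐ x ∂μ, ‖f x‖ ≤ M) :
    ‖f‖ ≤ M := by
  rw [Lp.norm_def, eLpNorm_exponent_top]
  exact ENNReal.toReal_le_of_le_ofReal hM (eLpNormEssSup_le_of_ae_bound h)

theorem exists_linftyToL2_eq [IsFiniteMeasure μ] {f : Lp ℂ 2 μ} {M : ℝ}
    (h : ∀ᵐ x ∂μ, ‖f x‖ ≤ M) : ∃ u, linftyToL2 μ u = f :=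
  ⟨⟨f.1, Lp.mem_Lp_iff_memLp.2 (memLp_top_of_bound (Lp.aestronglyMeasurable f) M h)⟩, rfl⟩

variable {V : Type*} [AddCommGroup V] [Module ℂ V] {𝔞 : SectorialForm V (Lp ℂ 2 μ)} {l ω K : ℝ}

theorem ae_norm_le_div_of_rel (h : IsSectorial (𝔞.shift ω) K) (hωl : ω < l) (hl : 0 < l)
    (hQ : ∀ u, ∃ w, Q μ (𝔞.j u) = 𝔞.j w ∧ 0 ≤ (𝔞.a w (u - w)).re) {x f : Lp ℂ 2 μ}
    (hx : 𝔞.Rel x (f - (l : ℂ) • x)) {M : ℝ} (hM : 0 < M) (hf : ∀ᵐ t ∂μ, ‖f t‖ ≤ M) :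
    ∀ᵐ t ∂μ, ‖x t‖ ≤ M / l := by
  have hf_scaled : ∀ᵐ t ∂μ, ‖((M : ℂ)⁻¹ • f) t‖ ≤ 1 := by
    refine ae_norm_coe_smul_le_iff.2 (hf.mono fun t ht => ?_)
    rwa [norm_inv, Complex.norm_of_nonneg hM.le, inv_mul_le_one₀ hM]
  have hx_scaled : 𝔞.Rel ((l / M : ℂ) • x) ((l : ℂ) • ((M : ℂ)⁻¹ • f - (l / M : ℂ) • x)) := by
    convert hx.smul (l / M : ℂ) using 1
    module
  have norm_le_one := ae_norm_coe_smul_le_iff.1 <|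
    SectorialForm.mem_of_rel_of_isMetricProjection h hωl hl.le isMetricProjection_Q
      (convex_setOf_ae_norm_le 1) hQ hf_scaled hx_scaled
  filter_upwards [norm_le_one] with t ht
  rw [norm_div, Complex.norm_of_nonneg hl.le, Complex.norm_of_nonneg hM.le,
    div_mul_eq_mul_div, div_le_one hM] at ht
  rwa [le_div_iff₀' hl]

variable [IsFiniteMeasure μ]

theorem exists_linftyToL2_eq_of_rel (h : IsSectorial (𝔞.shift ω) K) (hωl : ω < l) (hl : 0 < l)
    (hQ : ∀ u, ∃ w, Q μ (𝔞.j u) = 𝔞.j w ∧ 0 ≤ (𝔞.a w (u - w)).re) {x : Lp ℂ 2 μ}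
    {g : Lp ℂ ∞ μ} (hx : 𝔞.Rel x (linftyToL2 μ g - (l : ℂ) • x)) :
    ∃ u, linftyToL2 μ u = x ∧ l * ‖u‖ ≤ ‖g‖ := by
  have ae_norm_le {M : ℝ} (hM : ‖g‖ < M) : ∀ᵐ t ∂μ, ‖x t‖ ≤ M / l :=
    ae_norm_le_div_of_rel h hωl hl hQ hx ((norm_nonneg g).trans_lt hM)
      ((ae_norm_le_norm_linfty g).mono fun _ ht => ht.trans hM.le)
  obtain ⟨u, rfl⟩ := exists_linftyToL2_eq (ae_norm_le (lt_add_one ‖g‖))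
  refine ⟨u, rfl, le_of_forall_gt_imp_ge_of_dense fun M hM => ?_⟩
  have hM_pos := (norm_nonneg g).trans_lt hM
  exact (le_div_iff₀' hl).1 (norm_linfty_le (div_pos hM_pos hl).le (ae_norm_le hM))

theorem mem_graph_part_operator_iff {u v : Lp ℂ ∞ μ} :
    (u, v) ∈ (part 𝔞.operator (linftyToL2 μ)).graph ↔
      𝔞.Rel (linftyToL2 μ u) (linftyToL2 μ v) := by
  rw [← 𝔞.mem_graph_operator, mem_graph_part _ _ (linftyToL2_injective μ)]
  simp

theorem exists_smul_sub_neg_part_eq (h : IsSectorial (𝔞.shift ω) K) (hωl : ω < l) (hl : 0 < l)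
    (hQ : ∀ u, ∃ w, Q μ (𝔞.j u) = 𝔞.j w ∧ 0 ≤ (𝔞.a w (u - w)).re) (g : Lp ℂ ∞ μ) :
    ∃ u : (-part 𝔞.operator (linftyToL2 μ)).domain,
      (l : ℂ) • (u : Lp ℂ ∞ μ) - (-part 𝔞.operator (linftyToL2 μ)) u = g := by
  obtain ⟨x, hx⟩ := 𝔞.exists_rel_sub_smul h hωl (linftyToL2 μ g)
  obtain ⟨u, rfl, -⟩ := exists_linftyToL2_eq_of_rel h hωl hl hQ hx
  rw [← map_smul, ← map_sub] at hx
  obtain ⟨d, hd, apply_d⟩ :=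
    (LinearPMap.mem_graph_iff _).1 (mem_graph_part_operator_iff.2 hx)
  exact ⟨d, by rw [LinearPMap.neg_apply, apply_d, hd, sub_neg_eq_add, add_sub_cancel]⟩

theorem mul_norm_le_norm_smul_sub_neg_part (h : IsSectorial (𝔞.shift ω) K) (hωl : ω < l)
    (hl : 0 < l) (hQ : ∀ u, ∃ w, Q μ (𝔞.j u) = 𝔞.j w ∧ 0 ≤ (𝔞.a w (u - w)).re)
    (u : (-part 𝔞.operator (linftyToL2 μ)).domain) :
    l * ‖(u : Lp ℂ ∞ μ)‖ ≤
      ‖(l : ℂ) • (u : Lp ℂ ∞ μ) - (-part 𝔞.operator (linftyToL2 μ)) u‖ := by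
  have hu := mem_graph_part_operator_iff.1 ((part 𝔞.operator (linftyToL2 μ)).mem_graph u)
  rw [← add_sub_cancel_left ((l : ℂ) • (u : Lp ℂ ∞ μ)) (part _ _ u), map_sub, map_smul] at hu
  obtain ⟨u', hu', norm_le⟩ := exists_linftyToL2_eq_of_rel h hωl hl hQ hu
  rw [linftyToL2_injective μ hu'] at norm_le
  rwa [LinearPMap.neg_apply, sub_neg_eq_add]

end Lebesgue

end FormMethod

end

open FormMethod in
theorem corollary2p3 {X : Type*} [MeasurableSpace X] (μ : MeasureTheory.Measure X)
    [MeasureTheory.IsFiniteMeasure μ] {V : Type*} [AddCommGroup V] [Module ℂ V]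
    (𝔞 : FormMethod.SectorialForm V (MeasureTheory.Lp ℂ 2 μ))
    (hQ : ∀ u : V, ∃ w : V,
      FormMethod.Q μ (𝔞.j u) = 𝔞.j w ∧ 0 ≤ (𝔞.a w (u - w)).re) :
    FormMethod.IsMDissipative
      (-(FormMethod.part 𝔞.operator (FormMethod.linftyToL2 μ))) := by
  obtain ⟨ω, K, h⟩ := 𝔞.exists_isSectorial_shift
  refine isMDissipative_of_eventually ?_
  filter_upwards [eventually_gt_atTop ω, eventually_gt_atTop 0] with l hωl hl
  exact ⟨exists_smul_sub_neg_part_eq h hωl hl hQ, mul_norm_le_norm_smul_sub_neg_part h hωl hl hQ⟩
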